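/- Fix $N>0$ and a wavevector $\underline{k}=(m,n)\in\mathbb Z^2$ with $m,n>0$, and put $|\underline k|=\sqrt{m^2+n^2}$, $\Omega(\underline k)=N\,m/|\underline k|$. Consider the two-dimensional inviscid Boussinesq system in vorticity–buoyancy form $$\partial_t b=-N^2\partial_x\psi-\{b,\psi\},\qquad \partial_t\omega=-\partial_x b-\{\omega,\psi\},\qquad -\Delta\psi=\omega,$$ where $\{f,g\}=\partial_xf\,\partial_yg-\partial_yf\,\partial_xg$. Let $U\in\mathbb C^2\setminus\{0\}$ be such that, for every $\epsilon>0$, the plane wave $$\begin{pmatrix} b\\ \omega\end{pmatrix}(t,x)=\epsilon\,U e^{i(\underline k\cdot x-\Omega(\underline k)t)}+\text{c.c.},\qquad \psi=|\underline k|^{-2}\omega,$$ solves this system (for example $b=\epsilon\sin(\underline k\cdot x-\Omega(\underline k)t)$, $\omega=\frac{|\underline k|}{N}\,b$). Let $b_\epsilon,\omega_\epsilon,\psi_\epsilon$ be its profiles at $t=0$ and let $\underline c=\Omega(\underline k)\,\underline k/|\underline k|^2$ be its velocity. The linearization of the system at this wave, in the frame that moves with velocity $\underline c$, is $\partial_t(b,\omega)=\mathcal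 L_\epsilon(b,\omega)$ with $$\mathcal L_\epsilon\begin{pmatrix} b\\ \omega\end{pmatrix}=\begin{pmatrix}\underline c\cdot\nabla b-N^2\partial_x\psi-\{b,\psi_\epsilon\}-\{b_\epsilon,\psi\}\\ \underline c\cdot\nabla\omega-\partial_x b-\{\omega,\psi_\epsilon\}-\{\omega_\epsilon,\psi\}\end{pmatrix},\qquad \psi=(-\Delta)^{-1}\omega .$$ For $\mu\in\mathbb R^2$ let $\mathcal L_{\mu,\epsilon}=e^{-i\mu\cdot x}\mathcal L_\epsilon e^{i\mu\cdot x}$ be the corresponding Bloch–Floquet operator, obtained from $\mathcal L_\epsilon$ by replacing $\nabla$ with $\nabla+i\mu$ and $(-\Delta)^{-1}$ with the Fourier multiplier $|D+\mu|^{-2}$; it is an unbounded operator on $L^2(\mathbb T^2;\mathbb C^2)$, $\mathbb T^2=\mathbb R^2/(2\pi\mathbb Z)^2$, with domain $H^1(\mathbb T^2;\mathbb C^2)$. Then there exists $\epsilon_0>0$ such that for every $0<\epsilon\le\epsilon_0$ the operator $\mathcal L_\epsilon$ has an unstable eigenvalue, in the following sense: there are a Floquet exponent $\mu\in\mathbb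 R^2\setminus\mathbb Z^2$ and an eigenvalue $\lambda$ of $\mathcal L_{\mu,\epsilon}$ on $L^2(\mathbb T^2;\mathbb C^2)$ with $\operatorname{Re}\lambda>0$. (Equivalently, $\mathcal L_\epsilon h=\lambda h$ for some nonzero Bloch function $h(x)=e^{i\mu\cdot x}v(x)$ with $v\in H^1(\mathbb T^2;\mathbb C^2)$.) -/

import Mathlib

noncomputable section

namespace Boussinesq

open MeasureTheory Complex
open scoped ENNReal ComplexConjugate

/-! ### The nonlinear system and plane waves on the plane -/

/-- The partial derivative in `x` of a function on the plane. -/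
def dx (f : ℝ → ℝ → ℝ) (x y : ℝ) : ℝ := deriv (fun s => f s y) x

/-- The partial derivative in `y` of a function on the plane. -/
def dy (f : ℝ → ℝ → ℝ) (x y : ℝ) : ℝ := deriv (fun s => f x s) y

/-- The Poisson bracket `{f, g} = ∂ₓf ∂ᵧg - ∂ᵧf ∂ₓg`. -/
def poisson (f g : ℝ → ℝ → ℝ) (x y : ℝ) : ℝ := dx f x y * dy g x y - dy f x y * dx g x y

/-- Smooth solutions `(b, ω)`, with stream function `ψ`, all depending on `(t, x, y)`, of
`∂ₜb = -N² ∂ₓψ - {b, ψ}`, `∂ₜω = -∂ₓb - {ω, ψ}`, `-Δψ = ω`. -/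
structure IsSolution (N : ℝ) (b ω ψ : ℝ → ℝ → ℝ → ℝ) : Prop where
  smooth_b : ContDiff ℝ (⊤ : ℕ∞) fun p : ℝ × ℝ × ℝ => b p.1 p.2.1 p.2.2
  smooth_vorticity : ContDiff ℝ (⊤ : ℕ∞) fun p : ℝ × ℝ × ℝ => ω p.1 p.2.1 p.2.2
  smooth_stream : ContDiff ℝ (⊤ : ℕ∞) fun p : ℝ × ℝ × ℝ => ψ p.1 p.2.1 p.2.2
  buoyancy : ∀ t x y : ℝ,
    deriv (fun s => b s x y) t = -N ^ 2 * dx (ψ t) x y - poisson (b t) (ψ t) x y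
  vorticity : ∀ t x y : ℝ,
    deriv (fun s => ω s x y) t = -dx (b t) x y - poisson (ω t) (ψ t) x y
  stream : ∀ t x y : ℝ, -(dx (dx (ψ t)) x y + dy (dy (ψ t)) x y) = ω t x y

/-- The squared Euclidean length of a lattice vector. -/
def normSqZ (k : Fin 2 → ℤ) : ℝ := (k 0 : ℝ) ^ 2 + (k 1 : ℝ) ^ 2

/-- The frequency `Ω(k) = N k₁ / |k|`. -/
def freq (N : ℝ) (k : Fin 2 → ℤ) : ℝ := N * (k 0 : ℝ) / √(normSqZ k)

/-- The real plane wave `A e^{i (k · x - Ω t)} + c.c.` -/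
def planeWave (A : ℂ) (k : Fin 2 → ℤ) (Ω : ℝ) (t x y : ℝ) : ℝ :=
  2 * (A * exp (I * (((k 0 : ℝ) * x + (k 1 : ℝ) * y - Ω * t : ℝ) : ℂ))).re

/-! ### Function spaces on the torus

A point `θ` of `UnitAddTorus (Fin 2)` stands for the point `x = 2πθ` of `ℝ² / (2πℤ)²`. So
`UnitAddTorus.mFourier k` is `x ↦ e^{i k · x}`, the derivative `∂ⱼ` acts on it as
multiplication by `i kⱼ`, and the Haar probability measure is `dx / (2π)²`. -/

/-- The normalized Lebesgue measure of the torus. -/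
abbrev torusMeasure : Measure (UnitAddTorus (Fin 2)) :=
  Measure.pi fun _ : Fin 2 => (AddCircle.haarAddCircle : Measure UnitAddCircle)

/-- `L²(𝕋²; ℂ)`. -/
abbrev L2 : Type := Lp ℂ 2 torusMeasure

/-- The Fourier coefficients, as an isometry of `L²(𝕋²)` onto `ℓ²(ℤ²)`. -/
def fourierRepr : L2 ≃ₗᵢ[ℂ] lp (fun _ : Fin 2 → ℤ => ℂ) 2 :=
  (UnitAddTorus.mFourierBasis (d := Fin 2)).repr

/-- The Sobolev space `H¹(𝕋²; ℂ)`: those `f ∈ L²` with `∑ (1 + |k|²) |f̂(k)|² < ∞`. -/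
def H1 : Submodule ℂ L2 where
  carrier := {f | Memℓp (fun k => (√(1 + normSqZ k) : ℂ) * fourierRepr f k) 2}
  zero_mem' := by
    have h : Memℓp (fun _ : Fin 2 → ℤ => (0 : ℂ)) 2 := zero_memℓp
    simpa using h
  add_mem' := by
    intro f g hf hg
    have h := hf.add hg
    simp only [Set.mem_ofPred_eq, map_add]
    convert h using 1
    funext k
    simp [mul_add]
  smul_mem' := by
    intro c f hf
    have h := hf.const_mul c
    have e : (fun k => (√(1 + normSqZ k) : ℂ) * fourierRepr (c • f) k) =
        fun k => c * ((√(1 + normSqZ k) : ℂ) * fourierRepr f k) := by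
      funext k
      rw [map_smul, lp.coeFn_smul, Pi.smul_apply, smul_eq_mul]
      ring
    simpa only [Set.mem_ofPred_eq, e] using h

/-- A symbol of order at most one. -/
def IsOrderOne (m : (Fin 2 → ℤ) → ℂ) : Prop :=
  ∃ C : ℝ, ∀ k, ‖m k‖ ≤ C * √(1 + normSqZ k)

theorem memlp_symbol_mul {m : (Fin 2 → ℤ) → ℂ} (hm : IsOrderOne m) (f : H1) :
    Memℓp (fun k => m k * fourierRepr (f : L2) k) 2 := by
  obtain ⟨C, hC⟩ := hm
  have h : Memℓp (fun k => (√(1 + normSqZ k) : ℂ) * fourierRepr (f : L2) k) 2 := f.2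
  have h2 := (h.const_mul (C : ℂ)).summable (by norm_num)
  refine memℓp_gen (h2.of_nonneg_of_le (fun k => by positivity) fun k => ?_)
  refine Real.rpow_le_rpow (norm_nonneg _) ?_ (by norm_num)
  have h0 : 0 ≤ C * √(1 + normSqZ k) := (norm_nonneg _).trans (hC k)
  calc ‖m k * fourierRepr (f : L2) k‖ = ‖m k‖ * ‖fourierRepr (f : L2) k‖ := norm_mul _ _
    _ ≤ (C * √(1 + normSqZ k)) * ‖fourierRepr (f : L2) k‖ := by gcongr; exact hC k
    _ = ‖(C : ℂ) * ((√(1 + normSqZ k) : ℂ) * fourierRepr (f : L2) k)‖ := by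
      rw [← mul_assoc, norm_mul, ← ofReal_mul, norm_real, Real.norm_of_nonneg h0]

/-- The Fourier multiplier `m(D) : H¹(𝕋²) → L²(𝕋²)`, that is `f̂(k) ↦ m(k) f̂(k)`. -/
def multiplier (m : (Fin 2 → ℤ) → ℂ) (hm : IsOrderOne m) : H1 →ₗ[ℂ] L2 where
  toFun f := fourierRepr.symm ⟨fun k => m k * fourierRepr (f : L2) k, memlp_symbol_mul hm f⟩
  map_add' f g := by
    rw [← map_add]
    congr 1
    ext k
    simp only [Submodule.coe_add, map_add, lp.coeFn_add, Pi.add_apply, mul_add]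
  map_smul' c f := by
    rw [RingHom.id_apply, ← map_smul]
    congr 1
    ext k
    simp
    ring

/-- `|k + μ|²`. -/
def shiftSq (μ : Fin 2 → ℝ) (k : Fin 2 → ℤ) : ℝ := (k 0 + μ 0) ^ 2 + (k 1 + μ 1) ^ 2

/-- The symbol `i (kⱼ + μⱼ)` of `∂ⱼ + i μⱼ = e^{-i μ · x} ∂ⱼ e^{i μ · x}`. -/
def gradSymbol (μ : Fin 2 → ℝ) (j : Fin 2) (k : Fin 2 → ℤ) : ℂ := I * ((k j : ℝ) + μ j : ℝ)

/-- The symbol `i (kⱼ + μⱼ) / |k + μ|²` of `(∂ⱼ + i μⱼ) |D + μ|⁻²`; it vanishes at `k = -μ`. -/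
def streamSymbol (μ : Fin 2 → ℝ) (j : Fin 2) (k : Fin 2 → ℤ) : ℂ :=
  gradSymbol μ j k / (shiftSq μ k : ℂ)

theorem abs_coord_le (k : Fin 2 → ℤ) (j : Fin 2) : |(k j : ℝ)| ≤ √(1 + normSqZ k) := by
  apply Real.abs_le_sqrt
  unfold normSqZ
  fin_cases j <;> simp <;> nlinarith [sq_nonneg (k 0 : ℝ), sq_nonneg (k 1 : ℝ)]

theorem one_le_weight (k : Fin 2 → ℤ) : 1 ≤ √(1 + normSqZ k) := by
  rw [Real.one_le_sqrt]
  unfold normSqZ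
  nlinarith [sq_nonneg (k 0 : ℝ), sq_nonneg (k 1 : ℝ)]

theorem norm_gradSymbol (μ : Fin 2 → ℝ) (j : Fin 2) (k : Fin 2 → ℤ) :
    ‖gradSymbol μ j k‖ = |(k j : ℝ) + μ j| := by
  rw [gradSymbol, norm_mul, norm_I, one_mul, norm_real, Real.norm_eq_abs]

theorem isOrderOne_gradSymbol (μ : Fin 2 → ℝ) (j : Fin 2) : IsOrderOne (gradSymbol μ j) := by
  refine ⟨1 + |μ j|, fun k => ?_⟩
  rw [norm_gradSymbol]
  have h1 := abs_add_le (k j : ℝ) (μ j)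
  have h2 := abs_coord_le k j
  nlinarith [one_le_weight k, abs_nonneg (μ j)]

theorem finite_shiftSq_lt_one (μ : Fin 2 → ℝ) : {k : Fin 2 → ℤ | shiftSq μ k < 1}.Finite := by
  refine (Set.Finite.pi' (t := fun j => Set.Icc ⌊-μ j - 1⌋ ⌈-μ j + 1⌉)
    fun j => Set.finite_Icc _ _).subset fun k hk j => ?_
  have hk' : ((k 0 : ℝ) + μ 0) ^ 2 + ((k 1 : ℝ) + μ 1) ^ 2 < 1 := hk
  have h : ((k j : ℝ) + μ j) ^ 2 < 1 := by
    fin_cases j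
    · exact (le_add_of_nonneg_right (sq_nonneg _)).trans_lt hk'
    · exact (le_add_of_nonneg_left (sq_nonneg _)).trans_lt hk'
  have h' := abs_lt.1 ((sq_lt_one_iff_abs_lt_one _).1 h)
  constructor
  · have := (Int.floor_le (-μ j - 1)).trans (by linarith [h'.1] : -μ j - 1 ≤ (k j : ℝ))
    exact_mod_cast this
  · have := (by linarith [h'.2] : (k j : ℝ) ≤ -μ j + 1).trans (Int.le_ceil (-μ j + 1))
    exact_mod_cast this

theorem isOrderOne_streamSymbol (μ : Fin 2 → ℝ) (j : Fin 2) : IsOrderOne (streamSymbol μ j) := by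
  obtain ⟨C, hC⟩ := ((finite_shiftSq_lt_one μ).image fun k => ‖streamSymbol μ j k‖).bddAbove
  obtain ⟨G, hG⟩ := isOrderOne_gradSymbol μ j
  refine ⟨max C 0 + G, fun k => ?_⟩
  have hw := one_le_weight k
  have hG0 : 0 ≤ G * √(1 + normSqZ k) := (norm_nonneg _).trans (hG k)
  have hC0 : 0 ≤ max C 0 := le_max_right _ _
  rw [add_mul]
  by_cases hk : shiftSq μ k < 1
  · have h1 : ‖streamSymbol μ j k‖ ≤ C := hC ⟨k, hk, rfl⟩
    have h2 := le_max_left C 0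
    nlinarith
  · have h1 : ‖streamSymbol μ j k‖ ≤ ‖gradSymbol μ j k‖ := by
      rw [streamSymbol, norm_div]
      apply div_le_self (norm_nonneg _)
      rw [norm_real]
      exact (not_lt.1 hk).trans (le_abs_self _)
    have h2 := hG k
    nlinarith

/-- `∂ⱼ + i μⱼ` on `H¹(𝕋²)`. -/
def grad (μ : Fin 2 → ℝ) (j : Fin 2) : H1 →ₗ[ℂ] L2 :=
  multiplier (gradSymbol μ j) (isOrderOne_gradSymbol μ j)

/-- `(∂ⱼ + i μⱼ) ψ` as a function of `ω`, where `ψ = |D + μ|⁻² ω` is the stream function. -/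
def gradStream (μ : Fin 2 → ℝ) (j : Fin 2) : H1 →ₗ[ℂ] L2 :=
  multiplier (streamSymbol μ j) (isOrderOne_streamSymbol μ j)

/-- The product of an `L²` function with a continuous function. -/
def mulBy (g : C(UnitAddTorus (Fin 2), ℂ)) : L2 →L[ℂ] L2 :=
  (ContinuousLinearMap.mul ℂ ℂ).holderL torusMeasure ∞ 2 2
    (ContinuousMap.toLp (E := ℂ) ∞ torusMeasure ℂ g)

/-- The wave profile `A e^{i k · x} + c.c.` on the torus. -/
def wave (A : ℂ) (k : Fin 2 → ℤ) : C(UnitAddTorus (Fin 2), ℂ) :=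
  A • UnitAddTorus.mFourier k + conj A • UnitAddTorus.mFourier (-k)

/-- `∂ⱼ (A e^{i k · x} + c.c.) = i kⱼ A e^{i k · x} + c.c.` -/
def waveGrad (A : ℂ) (k : Fin 2 → ℤ) (j : Fin 2) : C(UnitAddTorus (Fin 2), ℂ) :=
  wave (I * (k j : ℂ) * A) k

/-- The bracket `{f, w}` of a function with gradient `F f` and of `w = A e^{i k · x} + c.c.` -/
def bracketWave (F : Fin 2 → H1 →ₗ[ℂ] L2) (A : ℂ) (k : Fin 2 → ℤ) : H1 →ₗ[ℂ] L2 :=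
  (mulBy (waveGrad A k 1)).toLinearMap ∘ₗ F 0 - (mulBy (waveGrad A k 0)).toLinearMap ∘ₗ F 1

/-- The linearized Bloch-Floquet operator `𝓛_μ = e^{-i μ · x} 𝓛 e^{i μ · x}`, an unbounded
operator on `L²(𝕋²; ℂ²)` with domain `H¹(𝕋²; ℂ²)`. Here `𝓛` is the linearization of the
Boussinesq system, in the frame that moves with velocity `c`, at the wave with profiles
`b₀ = B e^{i k · x} + c.c.`, `ω₀ = W e^{i k · x} + c.c.`, `ψ₀ = P e^{i k · x} + c.c.`:
`𝓛 (b, ω) = (c · ∇b - N² ∂ₓψ - {b, ψ₀} - {b₀, ψ}, c · ∇ω - ∂ₓb - {ω, ψ₀} - {ω₀, ψ})`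
with `ψ = (-Δ)⁻¹ ω`; the conjugation replaces `∇` by `∇ + i μ` and `-Δ` by `|D + μ|²`. -/
def linearized (N : ℝ) (c : Fin 2 → ℝ) (k : Fin 2 → ℤ) (B W P : ℂ) (μ : Fin 2 → ℝ) :
    (L2 × L2) →ₗ.[ℂ] (L2 × L2) where
  domain := H1.prod H1
  toFun :=
    let transport : H1 →ₗ[ℂ] L2 := (c 0 : ℂ) • grad μ 0 + (c 1 : ℂ) • grad μ 1
    -- the entries of the operator matrix; `{g, ψ} = -{ψ, g}`
    let bb : H1 →ₗ[ℂ] L2 := transport - bracketWave (grad μ) P k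
    let bω : H1 →ₗ[ℂ] L2 := -((N ^ 2 : ℝ) : ℂ) • gradStream μ 0 + bracketWave (gradStream μ) B k
    let ωb : H1 →ₗ[ℂ] L2 := -grad μ 0
    let ωω : H1 →ₗ[ℂ] L2 :=
      transport - bracketWave (grad μ) P k + bracketWave (gradStream μ) W k
    let fst : H1.prod H1 →ₗ[ℂ] H1 :=
      (LinearMap.fst ℂ L2 L2).restrict fun _ h => h.1
    let snd : H1.prod H1 →ₗ[ℂ] H1 :=
      (LinearMap.snd ℂ L2 L2).restrict fun _ h => h.2
    (bb ∘ₗ fst + bω ∘ₗ snd).prod (ωb ∘ₗ fst + ωω ∘ₗ snd)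

/-- The operator `𝓛_{μ,ε}` for the plane wave of amplitude `ε` with wavevector `k` and
polarization `U = (U₁, U₂)`: the profiles at time `0` are `(b₀, ω₀) = ε U e^{i k · x} + c.c.` and
`ψ₀ = (-Δ)⁻¹ ω₀ = |k|⁻² ω₀`, and the wave moves with the velocity `c = Ω(k) k / |k|²`. -/
def waveOperator (N : ℝ) (k : Fin 2 → ℤ) (U : ℂ × ℂ) (ε : ℝ) (μ : Fin 2 → ℝ) :
    (L2 × L2) →ₗ.[ℂ] (L2 × L2) :=
  linearized N (fun j => freq N k * (k j : ℝ) / normSqZ k) k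
    (ε * U.1) (ε * U.2) (ε * U.2 / (normSqZ k : ℂ)) μ

/-- `z` is an eigenvalue of the unbounded operator `T`. -/
def IsEigenvalue {X : Type*} [AddCommGroup X] [Module ℂ X] (T : X →ₗ.[ℂ] X) (z : ℂ) : Prop :=
  ∃ v : T.domain, (v : X) ≠ 0 ∧ T v = z • (v : X)

end Boussinesq

end

/-! The mechanism is the decay of the wave through a resonant triad. On Fourier modes `q = μ + j k`,
at `ε = 0`, the operator is diagonal with eigenvalues `i (c · q - s Ω(q))`, `s = ±1`. If `Ω(q) + Ω(q
- k) = Ω(k)`, the branch `+` at `q` and the branch `-` at `q - k` share one eigenvalue. The wave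
couples them at order `ε`. The two interaction coefficients have opposite signs
(`coupling_mul_coupling_neg`), and so do the amplitudes up to conjugation, `P` and `-conj P`; hence
the 2×2 matrix on the resonant pair has zero diagonal and off-diagonal product `σ² > 0`. The double
eigenvalue splits and one branch moves right at speed about `ε σ`.

To make this rigorous, write `μ = T k + h k^⊥`. The cross product `q × k` is constant along the line
`μ + ℤ k`, so the transport terms lose no derivative there: in the variables that diagonalize the
case `ε = 0`, the perturbation is a bounded band operator. The intermediate value theorem in `T`
gives the resonance (`exists_resonance`), and all other modes on the line keep a uniform distance
from the resonant frequency (`gap_of_resonance`). This suffices for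
`exists_eigenvalue_of_resonance`, a Lyapunov–Schmidt argument in a space of bounded sequences. The
modes are weighted by `2^{-|j|}`, which leaves the band operator bounded and puts the eigenfunction
in `H¹`. -/

noncomputable section

namespace Boussinesq

open MeasureTheory Complex Filter Topology BoundedContinuousFunction
open scoped ENNReal ComplexConjugate

/-! ### Splitting of a double eigenvalue of a diagonal operator -/

section Splitting

variable {ι : Type*} [TopologicalSpace ι] [DiscreteTopology ι] [DecidableEq ι]

/-- The indicator of a point, as a bounded function. -/
def pointMass (i : ι) : ι →ᵇ ℂ :=
  BoundedContinuousFunction.ofNormedAddCommGroupDiscrete (Pi.single i 1) 1 fun j => by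
    by_cases h : j = i
    · subst h; simp
    · simp [Pi.single_eq_of_ne h]

theorem pointMass_self (i : ι) : pointMass i i = 1 := by simp [pointMass]

theorem pointMass_of_ne {i j : ι} (h : j ≠ i) : pointMass i j = 0 := by
  simp [pointMass, Pi.single_eq_of_ne h]

/-- The reduced equation: `F (e, z, x) = (e, 0)` normalizes `x` at `i₁` and says that
`x + e r (z x - K x)` vanishes off `{i₁, i₂}` and `z x - K x` vanishes on `{i₁, i₂}`. -/
def reducedMap (K : (ι →ᵇ ℂ) →L[ℂ] (ι →ᵇ ℂ)) (r E : ι →ᵇ ℂ) (i₁ : ι)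
    (p : ℂ × ℂ × (ι →ᵇ ℂ)) : ℂ × ℂ × (ι →ᵇ ℂ) :=
  (p.1, evalCLM ℂ i₁ p.2.2 - 1,
    (1 - E) * p.2.2 + (E + p.1 • r) * (p.2.1 • p.2.2 - K p.2.2))

/-- Off the resonant pair the equation is divided by `ν - d i`, on the pair by `e`. The rescaled
system `reducedMap` is regular at `e = 0`, where it is solved by an eigenvector of the 2×2 block of
`K`; simplicity of `σ` (that is, `σ ≠ -σ`) makes its derivative onto. The diagonal `d` may be
unbounded, since only its reduced resolvent enters. -/
theorem exists_eigenvalue_of_resonance (K : (ι →ᵇ ℂ) →L[ℂ] (ι →ᵇ ℂ)) (d : ι → ℂ) (ν : ℂ)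
    {i₁ i₂ : ι} (hne : i₁ ≠ i₂) (h₁ : d i₁ = ν) (h₂ : d i₂ = ν) {g : ℝ} (hg : 0 < g)
    (hgap : ∀ i, i ≠ i₁ → i ≠ i₂ → g ≤ ‖ν - d i‖)
    (h11 : K (pointMass i₁) i₁ = 0) (h22 : K (pointMass i₂) i₂ = 0) {σ : ℂ} (hσ : 0 < σ.re)
    (h12 : K (pointMass i₂) i₁ * K (pointMass i₁) i₂ = σ ^ 2) :
    ∀ᶠ e : ℂ in 𝓝 0, ∃ z : ℂ, 0 < z.re ∧ ∃ x : ι →ᵇ ℂ, x ≠ 0 ∧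
      ∀ i, d i * x i + e * K x i = (ν + e * z) * x i := by
  have hσ0 : σ ≠ 0 := by rintro rfl; simp at hσ
  set M := K (pointMass i₂) i₁ with hM
  have hM0 : M ≠ 0 := by
    intro h; rw [h, zero_mul] at h12; exact hσ0 (pow_eq_zero_iff two_ne_zero |>.1 h12.symm)
  set E : ι →ᵇ ℂ := pointMass i₁ + pointMass i₂ with hE
  have E1 : E i₁ = 1 := by simp [hE, pointMass_self, pointMass_of_ne hne]
  have E2 : E i₂ = 1 := by simp [hE, pointMass_self, pointMass_of_ne hne.symm]
  have E0 : ∀ i, i ≠ i₁ → i ≠ i₂ → E i = 0 := fun i a b => by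
    simp [hE, pointMass_of_ne a, pointMass_of_ne b]
  -- Reduced resolvent of the diagonal at `ν`; the gap bounds it by `g⁻¹`.
  let r : ι →ᵇ ℂ := BoundedContinuousFunction.ofNormedAddCommGroupDiscrete
    (fun i => if i = i₁ ∨ i = i₂ then 0 else (ν - d i)⁻¹) g⁻¹ fun i => by
      split_ifs with h
      · simpa using hg.le
      · push Not at h
        rw [norm_inv]
        exact inv_anti₀ hg (hgap i h.1 h.2)
  have r1 : r i₁ = 0 := by simp [r]
  have r2 : r i₂ = 0 := by simp [r]
  have r0 : ∀ i, i ≠ i₁ → i ≠ i₂ → r i = (ν - d i)⁻¹ := fun i a b => by simp [r, a, b]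
  -- Eigenvector of the antidiagonal 2×2 block for the eigenvalue `σ`, normalized at `i₁`.
  set x₀ : ι →ᵇ ℂ := pointMass i₁ + (σ / M) • pointMass i₂ with hx₀
  have K1 : K x₀ i₁ = σ := by
    simp [hx₀, h11, ← hM]; field_simp
  have K2 : K x₀ i₂ = σ * (σ / M) := by
    have : K (pointMass i₁) i₂ = σ ^ 2 / M := by rw [← h12]; field_simp
    simp [hx₀, h22, this]; field_simp
  have x1 : x₀ i₁ = 1 := by simp [hx₀, pointMass_self, pointMass_of_ne hne]
  have x2 : x₀ i₂ = σ / M := by simp [hx₀, pointMass_self, pointMass_of_ne hne.symm]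
  have xo : ∀ i, i ≠ i₁ → i ≠ i₂ → x₀ i = 0 := fun i a b => by
    simp [hx₀, pointMass_of_ne a, pointMass_of_ne b]
  set a : ℂ × ℂ × (ι →ᵇ ℂ) := (0, σ, x₀) with ha
  -- the derivative
  have hfst : HasStrictFDerivAt (fun p : ℂ × ℂ × (ι →ᵇ ℂ) => p.1)
      (ContinuousLinearMap.fst ℂ ℂ (ℂ × (ι →ᵇ ℂ))) a := hasStrictFDerivAt_fst
  have hz : HasStrictFDerivAt (fun p : ℂ × ℂ × (ι →ᵇ ℂ) => p.2.1)
      ((ContinuousLinearMap.fst ℂ ℂ (ι →ᵇ ℂ)).comp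
        (ContinuousLinearMap.snd ℂ ℂ (ℂ × (ι →ᵇ ℂ)))) a :=
    ((ContinuousLinearMap.fst ℂ ℂ (ι →ᵇ ℂ)).comp
      (ContinuousLinearMap.snd ℂ ℂ (ℂ × (ι →ᵇ ℂ)))).hasStrictFDerivAt
  have hx : HasStrictFDerivAt (fun p : ℂ × ℂ × (ι →ᵇ ℂ) => p.2.2)
      ((ContinuousLinearMap.snd ℂ ℂ (ι →ᵇ ℂ)).comp
        (ContinuousLinearMap.snd ℂ ℂ (ℂ × (ι →ᵇ ℂ)))) a :=
    ((ContinuousLinearMap.snd ℂ ℂ (ι →ᵇ ℂ)).comp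
      (ContinuousLinearMap.snd ℂ ℂ (ℂ × (ι →ᵇ ℂ)))).hasStrictFDerivAt
  have hF :=
    hfst.prodMk ((((evalCLM ℂ i₁).hasStrictFDerivAt.comp a hx).sub_const 1).prodMk
      (((hx.const_mul (1 - E))).add
        (((hfst.smul_const r).const_add E).mul ((hz.smul hx).sub
          (K.hasStrictFDerivAt.comp a hx)))))
  -- Local openness is enough. As `e` is itself a component of the map, hitting `(e, 0, 0)` gives a
  -- solution for that very `e`.
  have hsurj : map (reducedMap K r E i₁) (𝓝 a) = 𝓝 (reducedMap K r E i₁ a) :=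
      hF.map_nhds_eq_of_surj <| by
    rw [LinearMap.range_eq_top]
    rintro ⟨e, c, y⟩
    -- the right-hand side after moving the `e` term
    set Y : ι →ᵇ ℂ := y - e • (r * (σ • x₀ - K x₀)) with hY
    set y' : ι →ᵇ ℂ := (1 - E) * Y with hy'
    have y1 : y' i₁ = 0 := by simp [hy', E1]
    have y2 : y' i₂ = 0 := by simp [hy', E2]
    have y0 : ∀ i, i ≠ i₁ → i ≠ i₂ → y' i = Y i := fun i p q => by simp [hy', E0 i p q]
    set A : ℂ := Y i₁ - σ * c + K y' i₁ with hA
    set B : ℂ := Y i₂ + K (pointMass i₁) i₂ * c + K y' i₂ with hB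
    -- The two equations at `i₁` and `i₂` for the unknowns `w, t`: eliminating `w` leaves `2 σ t` on
    -- one side.
    set t : ℂ := (B - σ / M * A) / (2 * σ) with ht
    set w : ℂ := A + M * t with hw
    set ξ : ι →ᵇ ℂ := c • pointMass i₁ + t • pointMass i₂ + y' with hξ
    have ξ1 : ξ i₁ = c := by simp [hξ, pointMass_self, pointMass_of_ne hne, y1]
    have ξ2 : ξ i₂ = t := by simp [hξ, pointMass_self, pointMass_of_ne hne.symm, y2]
    have ξ0 : ∀ i, i ≠ i₁ → i ≠ i₂ → ξ i = Y i := fun i p q => by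
      simp [hξ, pointMass_of_ne p, pointMass_of_ne q, y0 i p q]
    have Kξ1 : K ξ i₁ = t * M + K y' i₁ := by simp [hξ, h11, ← hM]
    have Kξ2 : K ξ i₂ = c * K (pointMass i₁) i₂ + K y' i₂ := by simp [hξ, h22]
    refine ⟨(e, w, ξ), ?_⟩
    refine Prod.ext ?_ (Prod.ext ?_ ?_)
    · simp
    · simp [ξ1]
    · ext i
      simp only [ha]
      by_cases p : i = i₁
      · subst p
        have : Y i = y i := by simp [hY, r1]
        simp [E1, r1, K1, x1, Kξ1, ξ1, hw, hA, this]
        ring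
      by_cases q : i = i₂
      · subst q
        have : Y i = y i := by simp [hY, r2]
        simp [E2, r2, K2, x2, Kξ2, ξ2]
        rw [hw, ← this]
        have : t * (2 * σ) = B - σ / M * A := by rw [ht]; field_simp
        have : σ * t + σ / M * (M * t) = B - σ / M * A := by rw [← this]; field_simp; ring
        rw [hB] at this
        linear_combination this
      · simp [E0 i p q, ξ0 i p q, hY, xo i p q]
        ring
  have hFa : reducedMap K r E i₁ a = (0, 0, 0) := by
    refine Prod.ext rfl (Prod.ext ?_ ?_)
    · simp [reducedMap, ha, x1]
    · ext i
      simp only [reducedMap, ha]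
      by_cases p : i = i₁
      · subst p; simp [E1, x1, K1]
      by_cases q : i = i₂
      · subst q; simp [E2, x2, K2]
      · simp [E0 i p q, xo i p q]
  have hpos : ∀ᶠ p : ℂ × ℂ × (ι →ᵇ ℂ) in 𝓝 a, 0 < p.2.1.re :=
    (Complex.continuous_re.comp (continuous_fst.comp continuous_snd)).continuousAt.eventually
      (lt_mem_nhds hσ)
  have himage := hsurj ▸ image_mem_map (m := reducedMap K r E i₁) hpos
  rw [hFa] at himage
  have hc : Tendsto (fun e : ℂ => (e, (0 : ℂ), (0 : ι →ᵇ ℂ))) (𝓝 0) (𝓝 (0, 0, 0)) :=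
    Continuous.tendsto (by fun_prop) 0
  filter_upwards [hc himage] with e he
  obtain ⟨⟨e', z, x⟩, hz, hp⟩ := he
  obtain rfl : e' = e := congrArg Prod.fst hp
  have hx1 : x i₁ = 1 := sub_eq_zero.1 (congrArg (fun p => p.2.1) hp)
  have hx : (1 - E) * x + (E + e' • r) * (z • x - K x) = 0 := congrArg (fun p => p.2.2) hp
  refine ⟨z, hz, x, fun h => by simp [h] at hx1, fun i => ?_⟩
  have hi := DFunLike.congr_fun hx i
  by_cases p : i = i₁
  · subst p
    simp [E1, r1] at hi
    rw [h₁]; linear_combination (-e') * hi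
  by_cases q : i = i₂
  · subst q
    simp [E2, r2] at hi
    rw [h₂]; linear_combination (-e') * hi
  · simp [E0 i p q, r0 i p q] at hi
    have hd : ν - d i ≠ 0 := fun h => by
      have := hgap i p q
      rw [h, norm_zero] at this
      linarith
    field_simp at hi
    linear_combination -hi

end Splitting

/-! ### Products with waves on the Fourier side -/

theorem fourierRepr_mulBy_mFourier (k : Fin 2 → ℤ) (f : L2) (p : Fin 2 → ℤ) :
    fourierRepr (mulBy (UnitAddTorus.mFourier k) f) p = fourierRepr f (p - k) := by
  have h1 := UnitAddTorus.mFourierBasis_repr (d := Fin 2) (mulBy (UnitAddTorus.mFourier k) f) p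
  have h2 := UnitAddTorus.mFourierBasis_repr (d := Fin 2) f (p - k)
  refine h1.trans (Eq.trans ?_ h2.symm)
  refine integral_congr_ae ?_
  have e1 : (mulBy (UnitAddTorus.mFourier k) f : L2) =ᵐ[torusMeasure] _ :=
    (ContinuousLinearMap.mul ℂ ℂ).coeFn_holder (r := 2)
      (ContinuousMap.toLp (E := ℂ) ∞ torusMeasure ℂ (UnitAddTorus.mFourier k)) f
  have e2 := ContinuousMap.coeFn_toLp (p := ∞) (𝕜 := ℂ) torusMeasure (UnitAddTorus.mFourier k)
  filter_upwards [e1, e2] with x h1 h2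
  rw [h1, h2, ContinuousLinearMap.mul_apply', smul_eq_mul, smul_eq_mul, ← mul_assoc,
    ← UnitAddTorus.mFourier_add, neg_sub, neg_add_eq_sub]

theorem fourierRepr_mulBy_wave (A : ℂ) (k : Fin 2 → ℤ) (f : L2) (p : Fin 2 → ℤ) :
    fourierRepr (mulBy (wave A k) f) p =
      A * fourierRepr f (p - k) + conj A * fourierRepr f (p + k) := by
  have h : mulBy (wave A k) f = A • mulBy (UnitAddTorus.mFourier k) f +
      conj A • mulBy (UnitAddTorus.mFourier (-k)) f := by
    simp only [mulBy, wave, map_add, map_smul, _root_.add_apply,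
      _root_.smul_apply]
  rw [h, map_add, map_smul, map_smul, lp.coeFn_add, Pi.add_apply, lp.coeFn_smul, lp.coeFn_smul,
    Pi.smul_apply, Pi.smul_apply, fourierRepr_mulBy_mFourier, fourierRepr_mulBy_mFourier,
    smul_eq_mul, smul_eq_mul, sub_neg_eq_add]

theorem fourierRepr_multiplier (m : (Fin 2 → ℤ) → ℂ) (hm : IsOrderOne m) (f : H1)
    (p : Fin 2 → ℤ) : fourierRepr (multiplier m hm f) p = m p * fourierRepr (f : L2) p := by
  simp [multiplier]

theorem fourierRepr_bracketWave (F : Fin 2 → H1 →ₗ[ℂ] L2) (A : ℂ) (k : Fin 2 → ℤ) (f : H1)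
    (p : Fin 2 → ℤ) :
    fourierRepr (bracketWave F A k f) p =
      I * A * ((k 1 : ℂ) * fourierRepr (F 0 f) (p - k) - (k 0 : ℂ) * fourierRepr (F 1 f) (p - k)) -
      I * conj A * ((k 1 : ℂ) * fourierRepr (F 0 f) (p + k) -
        (k 0 : ℂ) * fourierRepr (F 1 f) (p + k)) := by
  simp only [bracketWave, waveGrad, LinearMap.sub_apply, LinearMap.comp_apply,
    ContinuousLinearMap.coe_coe, map_sub, lp.coeFn_sub, Pi.sub_apply, fourierRepr_mulBy_wave,
    map_mul, conj_I, map_intCast]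
  ring

/-- `q × k` for `q = p + μ`. -/
def crossShift (μ : Fin 2 → ℝ) (k p : Fin 2 → ℤ) : ℝ :=
  (p 0 + μ 0) * k 1 - (p 1 + μ 1) * k 0

/-- The shift by `±k` does not change `q × k`, so the factor can be taken at the output mode `p`. -/
theorem fourierRepr_bracketWave_grad (μ : Fin 2 → ℝ) (A : ℂ) (k : Fin 2 → ℤ) (f : H1)
    (p : Fin 2 → ℤ) :
    fourierRepr (bracketWave (grad μ) A k f) p = -(crossShift μ k p *
      (A * fourierRepr (f : L2) (p - k) - conj A * fourierRepr (f : L2) (p + k))) := by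
  rw [fourierRepr_bracketWave]
  simp only [grad, fourierRepr_multiplier, gradSymbol, crossShift]
  simp only [Pi.add_apply, Pi.sub_apply]
  push_cast
  linear_combination ((k 1 * (p 0 + μ 0) - k 0 * (p 1 + μ 1)) *
      (A * fourierRepr (f : L2) (p - k) - conj A * fourierRepr (f : L2) (p + k))) * I_sq

theorem fourierRepr_bracketWave_gradStream (μ : Fin 2 → ℝ) (A : ℂ) (k : Fin 2 → ℤ) (f : H1)
    (p : Fin 2 → ℤ) :
    fourierRepr (bracketWave (gradStream μ) A k f) p = -(crossShift μ k p *
      (A * (fourierRepr (f : L2) (p - k) / shiftSq μ (p - k)) -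
        conj A * (fourierRepr (f : L2) (p + k) / shiftSq μ (p + k)))) := by
  rw [fourierRepr_bracketWave]
  simp only [gradStream, fourierRepr_multiplier, streamSymbol, gradSymbol, crossShift]
  simp only [Pi.add_apply, Pi.sub_apply]
  push_cast
  linear_combination ((k 1 * (p 0 + μ 0) - k 0 * (p 1 + μ 1)) *
      (A * (fourierRepr (f : L2) (p - k) / shiftSq μ (p - k)) -
        conj A * (fourierRepr (f : L2) (p + k) / shiftSq μ (p + k)))) * I_sq

/-- The equations for the Fourier coefficients of an eigenfunction. -/
theorem isEigenvalue_linearized_of_coeff {N : ℝ} {c : Fin 2 → ℝ} {k : Fin 2 → ℤ} {B W P : ℂ}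
    {μ : Fin 2 → ℝ} {z : ℂ} (f g : H1) (hne : (f : L2) ≠ 0 ∨ (g : L2) ≠ 0)
    (hb : ∀ p : Fin 2 → ℤ, I * (c 0 * (p 0 + μ 0) + c 1 * (p 1 + μ 1)) * fourierRepr (f : L2) p -
        N ^ 2 * (I * (p 0 + μ 0)) * (fourierRepr (g : L2) p / shiftSq μ p) +
        crossShift μ k p *
          (P * fourierRepr (f : L2) (p - k) - conj P * fourierRepr (f : L2) (p + k)) -
        crossShift μ k p * (B * (fourierRepr (g : L2) (p - k) / shiftSq μ (p - k)) -
          conj B * (fourierRepr (g : L2) (p + k) / shiftSq μ (p + k))) =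
      z * fourierRepr (f : L2) p)
    (hω : ∀ p : Fin 2 → ℤ, I * (c 0 * (p 0 + μ 0) + c 1 * (p 1 + μ 1)) * fourierRepr (g : L2) p -
        I * (p 0 + μ 0) * fourierRepr (f : L2) p +
        crossShift μ k p *
          (P * fourierRepr (g : L2) (p - k) - conj P * fourierRepr (g : L2) (p + k)) -
        crossShift μ k p * (W * (fourierRepr (g : L2) (p - k) / shiftSq μ (p - k)) -
          conj W * (fourierRepr (g : L2) (p + k) / shiftSq μ (p + k))) =
      z * fourierRepr (g : L2) p) :
    IsEigenvalue (linearized N c k B W P μ) z := by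
  refine ⟨⟨(f, g), f.2, g.2⟩, fun h => hne.elim (· (congrArg Prod.fst h))
    (· (congrArg Prod.snd h)), ?_⟩
  refine Prod.ext ?_ ?_
  · apply fourierRepr.injective
    ext p
    have e : fourierRepr ((linearized N c k B W P μ ⟨((f : L2), (g : L2)), f.2, g.2⟩).1) p =
      fourierRepr ((((c 0 : ℂ) • grad μ 0 + (c 1 : ℂ) • grad μ 1) - bracketWave (grad μ) P k) f +
        (-((N ^ 2 : ℝ) : ℂ) • gradStream μ 0 + bracketWave (gradStream μ) B k) g) p := rfl
    rw [e]
    simp only [LinearMap.add_apply, LinearMap.sub_apply, LinearMap.smul_apply, map_add, map_sub,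
      map_smul, lp.coeFn_add, lp.coeFn_sub, lp.coeFn_smul, Pi.add_apply, Pi.sub_apply,
      Pi.smul_apply, fourierRepr_bracketWave_grad, fourierRepr_bracketWave_gradStream, Prod.smul_mk]
    simp only [grad, gradStream, fourierRepr_multiplier, streamSymbol, gradSymbol, smul_eq_mul]
    rw [← hb p]
    push_cast
    ring
  · apply fourierRepr.injective
    ext p
    have e : fourierRepr ((linearized N c k B W P μ ⟨((f : L2), (g : L2)), f.2, g.2⟩).2) p =
      fourierRepr ((-grad μ 0) f + (((c 0 : ℂ) • grad μ 0 + (c 1 : ℂ) • grad μ 1) -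
        bracketWave (grad μ) P k + bracketWave (gradStream μ) W k) g) p := rfl
    rw [e]
    simp only [LinearMap.add_apply, LinearMap.sub_apply, LinearMap.smul_apply, map_add, map_sub,
      map_smul, lp.coeFn_add, lp.coeFn_sub, lp.coeFn_smul, Pi.add_apply, Pi.sub_apply,
      Pi.smul_apply, fourierRepr_bracketWave_grad, fourierRepr_bracketWave_gradStream, Prod.smul_mk,
      LinearMap.neg_apply, map_neg, lp.coeFn_neg, Pi.neg_apply]
    simp only [grad, fourierRepr_multiplier, gradSymbol, smul_eq_mul]
    rw [← hω p]
    push_cast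
    ring

/-! ### Eigenfunctions with Fourier coefficients on a line -/

theorem summable_sq_weight_mul_geometric (c : ℝ) :
    Summable fun j : ℤ => (c * (1 + (j.natAbs : ℝ)) ^ 2 * (1 / 2) ^ j.natAbs) ^ 2 := by
  have h : Summable fun n : ℕ => (c * (1 + (n : ℝ)) ^ 2 * (1 / 2) ^ n) ^ 2 := by
    have h1 := (summable_nat_add_iff 1).2 (summable_pow_mul_geometric_of_norm_lt_one (R := ℝ) 4
      (r := 1 / 4) (by norm_num))
    refine (h1.mul_left (4 * c ^ 2)).congr fun n => ?_
    rw [pow_succ (1 / 4 : ℝ), show (1 / 4 : ℝ) ^ n = ((1 / 2) ^ n) ^ 2 by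
      rw [← pow_mul, mul_comm, pow_mul]; norm_num]
    push_cast
    ring
  exact Summable.of_nat_of_neg (by simpa using h) (by simpa using h)

theorem smul_injective_of_ne_zero {k : Fin 2 → ℤ} (hk : k ≠ 0) :
    Function.Injective fun j : ℤ => j • k := fun _ _ h => smul_left_injective ℤ hk h

theorem normSqZ_smul (j : ℤ) (k : Fin 2 → ℤ) : normSqZ (j • k) = (j : ℝ) ^ 2 * normSqZ k := by
  simp [normSqZ]; ring

theorem normSqZ_nonneg (k : Fin 2 → ℤ) : 0 ≤ normSqZ k := by unfold normSqZ; positivity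

theorem sqrt_one_add_normSqZ_smul_le (j : ℤ) (k : Fin 2 → ℤ) :
    √(1 + normSqZ (j • k)) ≤ (1 + √(normSqZ k)) * (1 + j.natAbs) := by
  have hj : (j : ℝ) ^ 2 = (j.natAbs : ℝ) ^ 2 := by
    rw [Nat.cast_natAbs, Int.cast_abs, sq_abs]
  rw [Real.sqrt_le_left (by positivity), normSqZ_smul, hj]
  have h := Real.sq_sqrt (normSqZ_nonneg k)
  have h0 := Real.sqrt_nonneg (normSqZ k)
  have hn : (0 : ℝ) ≤ j.natAbs := by positivity
  generalize (j.natAbs : ℝ) = a at *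
  generalize √(normSqZ k) = r at *
  rw [← h]
  have : 0 ≤ a * r := by positivity
  nlinarith [mul_nonneg this h0, mul_nonneg this hn]

/-- A sequence with exponential decay is the sequence of Fourier coefficients, along the line
`ℤ k`, of a function in `H¹`. -/
theorem exists_fourierRepr_eq_extend {k : Fin 2 → ℤ} (hk : k ≠ 0) (β : ℤ → ℂ) (C : ℝ)
    (hβ : ∀ j, ‖β j‖ ≤ C * (1 + j.natAbs) * (1 / 2) ^ j.natAbs) :
    ∃ f : H1, ∀ p, fourierRepr (f : L2) p = Function.extend (fun j : ℤ => j • k) β 0 p := by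
  have hinj := smul_injective_of_ne_zero hk
  have hoff : ∀ p ∉ Set.range (fun j : ℤ => j • k),
      Function.extend (fun j : ℤ => j • k) β 0 p = 0 := fun p hp =>
    Function.extend_apply' _ _ _ (by simpa using hp)
  have hw : Memℓp (fun p => (√(1 + normSqZ p) : ℂ) *
      Function.extend (fun j : ℤ => j • k) β 0 p) 2 := by
    refine memℓp_gen ?_
    rw [← hinj.summable_iff]
    · refine (summable_sq_weight_mul_geometric ((1 + √(normSqZ k)) * C)).of_nonneg_of_le
        (fun j => Real.rpow_nonneg (norm_nonneg _) _) fun j => ?_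
      simp only [Function.comp_apply, hinj.extend_apply]
      rw [ENNReal.toReal_ofNat, Real.rpow_ofNat, norm_mul, norm_real,
        Real.norm_of_nonneg (Real.sqrt_nonneg _)]
      refine pow_le_pow_left₀ (by positivity) ?_ 2
      calc √(1 + normSqZ (j • k)) * ‖β j‖
          ≤ ((1 + √(normSqZ k)) * (1 + j.natAbs)) * (C * (1 + j.natAbs) * (1 / 2) ^ j.natAbs) :=
            mul_le_mul (sqrt_one_add_normSqZ_smul_le j k) (hβ j) (norm_nonneg _) (by positivity)
        _ = _ := by ring
    · intro p hp
      rw [hoff p hp]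
      simp
  have h2 : Memℓp (Function.extend (fun j : ℤ => j • k) β 0) 2 := by
    refine memℓp_gen ((hw.summable (by norm_num)).of_nonneg_of_le (fun p => by positivity)
      fun p => ?_)
    refine Real.rpow_le_rpow (norm_nonneg _) ?_ (by norm_num)
    rw [norm_mul, norm_real, Real.norm_of_nonneg (Real.sqrt_nonneg _)]
    exact le_mul_of_one_le_left (norm_nonneg _) (one_le_weight p)
  refine ⟨⟨fourierRepr.symm ⟨_, h2⟩, ?_⟩, fun p => ?_⟩
  · change Memℓp _ 2
    simpa using hw
  · simp

/-- The operator preserves functions with frequencies in `ℤ k`: off this line all neighbours are off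
it too and both equations read `0 = 0`. -/
theorem isEigenvalue_linearized_of_line {N : ℝ} {c : Fin 2 → ℝ} {k : Fin 2 → ℤ} (hk : k ≠ 0)
    {B W P : ℂ} {μ : Fin 2 → ℝ} {z : ℂ} (β γ : ℤ → ℂ) (C : ℝ)
    (hβ : ∀ j, ‖β j‖ ≤ C * (1 + j.natAbs) * (1 / 2) ^ j.natAbs)
    (hγ : ∀ j, ‖γ j‖ ≤ C * (1 + j.natAbs) * (1 / 2) ^ j.natAbs)
    {j₀ : ℤ} (hne : β j₀ ≠ 0 ∨ γ j₀ ≠ 0)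
    (hb : ∀ j : ℤ, I * (c 0 * (j * k 0 + μ 0) + c 1 * (j * k 1 + μ 1)) * β j -
        N ^ 2 * (I * (j * k 0 + μ 0)) * (γ j / shiftSq μ (j • k)) +
        crossShift μ k 0 * (P * β (j - 1) - conj P * β (j + 1)) -
        crossShift μ k 0 * (B * (γ (j - 1) / shiftSq μ ((j - 1) • k)) -
          conj B * (γ (j + 1) / shiftSq μ ((j + 1) • k))) = z * β j)
    (hω : ∀ j : ℤ, I * (c 0 * (j * k 0 + μ 0) + c 1 * (j * k 1 + μ 1)) * γ j -
        I * (j * k 0 + μ 0) * β j +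
        crossShift μ k 0 * (P * γ (j - 1) - conj P * γ (j + 1)) -
        crossShift μ k 0 * (W * (γ (j - 1) / shiftSq μ ((j - 1) • k)) -
          conj W * (γ (j + 1) / shiftSq μ ((j + 1) • k))) = z * γ j) :
    IsEigenvalue (linearized N c k B W P μ) z := by
  obtain ⟨f, hf⟩ := exists_fourierRepr_eq_extend hk β C hβ
  obtain ⟨g, hg⟩ := exists_fourierRepr_eq_extend hk γ C hγ
  have hinj := smul_injective_of_ne_zero hk
  have hval : ∀ (β : ℤ → ℂ) (j : ℤ), Function.extend (fun j : ℤ => j • k) β 0 (j • k) = β j :=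
    fun β j => hinj.extend_apply β 0 j
  have hoff : ∀ (β : ℤ → ℂ) (p : Fin 2 → ℤ), (¬ ∃ j : ℤ, j • k = p) →
      Function.extend (fun j : ℤ => j • k) β 0 p = 0 :=
    fun β p hp => Function.extend_apply' β (0 : (Fin 2 → ℤ) → ℂ) p hp
  have hsub : ∀ j : ℤ, j • k - k = (j - 1) • k := fun j => by rw [sub_smul, one_smul]
  have hadd : ∀ j : ℤ, j • k + k = (j + 1) • k := fun j => by rw [add_smul, one_smul]
  have hcross : ∀ j : ℤ, crossShift μ k (j • k) = crossShift μ k 0 := fun j => by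
    simp [crossShift]; ring
  have hoff' : ∀ p : Fin 2 → ℤ, (¬ ∃ j : ℤ, j • k = p) →
      (¬ ∃ j : ℤ, j • k = p - k) ∧ ¬ ∃ j : ℤ, j • k = p + k := fun p hp =>
    ⟨fun ⟨j, hj⟩ => hp ⟨j + 1, by rw [← hadd, hj, sub_add_cancel]⟩,
      fun ⟨j, hj⟩ => hp ⟨j - 1, by rw [← hsub, hj, add_sub_cancel_right]⟩⟩
  refine isEigenvalue_linearized_of_coeff f g ?_ ?_ ?_
  · refine hne.imp (fun h h0 => h ?_) fun h h0 => h ?_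
    · rw [← hval β, ← hf, h0, map_zero]; rfl
    · rw [← hval γ, ← hg, h0, map_zero]; rfl
  · intro p
    simp only [hf, hg]
    by_cases hp : ∃ j : ℤ, j • k = p
    · obtain ⟨j, rfl⟩ := hp
      rw [hsub, hadd, hcross]
      simp only [hval]
      rw [← hb j]
      simp
    · rw [hoff β p hp, hoff γ p hp, hoff β _ (hoff' p hp).1, hoff γ _ (hoff' p hp).1,
        hoff β _ (hoff' p hp).2, hoff γ _ (hoff' p hp).2]
      simp
  · intro p
    simp only [hf, hg]
    by_cases hp : ∃ j : ℤ, j • k = p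
    · obtain ⟨j, rfl⟩ := hp
      rw [hsub, hadd, hcross]
      simp only [hval]
      rw [← hω j]
      simp
    · rw [hoff β p hp, hoff γ p hp, hoff γ _ (hoff' p hp).1, hoff γ _ (hoff' p hp).2]
      simp

/-! ### The coupled modes -/

/-- The operator `y ↦ ∑ r, g r * (y ∘ τ r)` on bounded functions. -/
def bandOperator {ι R : Type*} [TopologicalSpace ι] [DiscreteTopology ι] [Fintype R]
    (g : R → ι →ᵇ ℂ) (τ : R → ι → ι) : (ι →ᵇ ℂ) →L[ℂ] (ι →ᵇ ℂ) :=
  LinearMap.mkContinuous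
    { toFun := fun y => ∑ r, g r * y.compContinuous ⟨τ r, continuous_of_discreteTopology⟩
      map_add' := fun x y => by
        simp only [← Finset.sum_add_distrib, ← mul_add]
        rfl
      map_smul' := fun c y => by
        simp only [RingHom.id_apply, Finset.smul_sum, ← mul_smul_comm]
        rfl }
    (∑ r, ‖g r‖) fun y => by
      rw [Finset.sum_mul]
      refine (norm_sum_le _ _).trans (Finset.sum_le_sum fun r _ => (norm_mul_le _ _).trans ?_)
      gcongr
      exact norm_compContinuous_le _ _

theorem bandOperator_apply {ι R : Type*} [TopologicalSpace ι] [DiscreteTopology ι] [Fintype R]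
    (g : R → ι →ᵇ ℂ) (τ : R → ι → ι) (y : ι →ᵇ ℂ) (i : ι) :
    bandOperator g τ y i = ∑ r, g r i * y (τ r i) := by
  simp [bandOperator, BoundedContinuousFunction.coe_sum]

/-- The sign of a branch of the dispersion relation. -/
def sgn (s : Bool) : ℝ := if s then 1 else -1

/-- The interaction coefficient between the branch `s'` at length `l` and the branch `s` at
length `r`, mediated by a wave of wavenumber `K`. -/
def coupling (κ K r l : ℝ) (s s' : Bool) : ℝ :=
  κ / 2 * (1 - sgn s' * K / l + sgn s * sgn s' * (l ^ 2 - K ^ 2) / (l * r))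

/-- Since `l < r + K < 2 r`, the ratio `l / r` is at most `2`; this makes the band operator bounded
uniformly in `j`. -/
theorem abs_coupling_le {κ K r l : ℝ} (hK : 0 < K) (hr : K < r) (hl : K < l) (h : l < r + K)
    (s s' : Bool) : |coupling κ K r l s s'| ≤ 2 * |κ| := by
  have hl0 := hK.trans hl
  have hr0 := hK.trans hr
  have h1 : K / l ≤ 1 := (div_le_one hl0).2 hl.le
  have h1' : 0 ≤ K / l := by positivity
  have h2 : (l ^ 2 - K ^ 2) / (l * r) ≤ 2 := by
    rw [div_le_iff₀ (by positivity)]; nlinarith [mul_pos hl0 hr0]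
  have h2' : 0 ≤ (l ^ 2 - K ^ 2) / (l * r) := by
    apply div_nonneg _ (by positivity); nlinarith
  have : |1 - sgn s' * K / l + sgn s * sgn s' * (l ^ 2 - K ^ 2) / (l * r)| ≤ 4 := by
    simp only [mul_div_assoc]
    rw [abs_le]
    constructor <;> cases s <;> cases s' <;> simp only [sgn] <;> norm_num <;> linarith
  rw [coupling, abs_mul, abs_div, abs_two]
  nlinarith [abs_nonneg κ]

/-- The two couplings of the resonant pair have opposite signs. -/
theorem coupling_mul_coupling_neg {κ K r l : ℝ} (hκ : κ ≠ 0) (hK : 0 < K) (hr : K < r)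
    (hl : K < l) (h : l < r + K) :
    coupling κ K r l true false * coupling κ K l r false true < 0 := by
  have hl0 := hK.trans hl
  have hr0 := hK.trans hr
  -- The two factors are `κ (l + K) (r + K - l) / (2 l r)` and `-κ (r - K) (r + K - l) / (2 l r)`.
  have e : coupling κ K r l true false * coupling κ K l r false true =
      -((κ / (2 * l * r)) ^ 2 * (l + K) * (r - K) * (r + K - l) ^ 2) := by
    simp only [coupling, sgn, if_true, Bool.false_eq_true, if_false]
    field_simp
    ring
  rw [e, neg_lt_zero]
  have h1 : 0 < r - K := by linarith
  have h2 : 0 < r + K - l := by linarith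
  positivity

/-- The weight `2^{-|j|}`. -/
def decay (j : ℤ) : ℝ := (1 / 2) ^ j.natAbs

theorem decay_pos (j : ℤ) : 0 < decay j := by unfold decay; positivity

theorem decay_le {i j : ℤ} (h : j.natAbs ≤ i.natAbs + 1) : decay i ≤ 2 * decay j := by
  have := pow_le_pow_of_le_one (by norm_num : (0 : ℝ) ≤ 1 / 2) (by norm_num) h
  rw [pow_succ] at this
  unfold decay
  linarith

/-- The neighbour of `j` to the right or to the left. -/
def neighbour (δ : Bool) (j : ℤ) : ℤ := if δ then j + 1 else j - 1

theorem natAbs_le_neighbour (δ : Bool) (j : ℤ) : j.natAbs ≤ (neighbour δ j).natAbs + 1 := by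
  cases δ <;> simp [neighbour] <;> omega

/-- The amplitude with which the wave `P e^{i k · x} + c.c.` acts on a neighbour. -/
def waveAmplitude (P : ℂ) (δ : Bool) : ℂ := if δ then -conj P else P

theorem norm_waveAmplitude (P : ℂ) (δ : Bool) : ‖waveAmplitude P δ‖ = ‖P‖ := by
  cases δ <;> simp [waveAmplitude]

/-- Here `N χ j` stands for `Ω(q)` at `q = μ + j k`, `ρ j` for `|q|`, `N C` for `Ω(k) = c · k` and
`θ` for `c · μ`. The resonant pair is `(0, +)`, `(-1, -)`. The abstract splitting is applied to the
band operator conjugated by the weight `decay`. -/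
theorem exists_unstable_modes {N K κ C θ g : ℝ} (hN : 0 < N) (hK : 0 < K) (hκ : κ ≠ 0)
    {ρ χ : ℤ → ℝ} (hρ : ∀ j, K < ρ j) (hnb : ∀ δ j, ρ (neighbour δ j) < ρ j + K)
    (hres : χ 0 + χ (-1) = C) (hg : 0 < g)
    (hgap : ∀ j s, (j, s) ≠ ((0 : ℤ), true) → (j, s) ≠ ((-1 : ℤ), false) →
      g ≤ |χ 0 + j * C - sgn s * χ j|) {P : ℂ} (hP : P ≠ 0) :
    ∀ᶠ e : ℂ in 𝓝 0, ∃ z : ℂ, 0 < z.re ∧ ∃ y : ℤ × Bool →ᵇ ℂ, y ≠ 0 ∧ ∀ j s,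
      I * (θ + N * (j * C - sgn s * χ j) : ℝ) * (decay j * y (j, s)) +
        e * ∑ r : Bool × Bool, waveAmplitude P r.1 *
          coupling κ K (ρ j) (ρ (neighbour r.1 j)) s r.2 *
            (decay (neighbour r.1 j) * y (neighbour r.1 j, r.2)) =
      (I * (θ - N * χ 0 : ℝ) + e * z) * (decay j * y (j, s)) := by
  let G : Bool × Bool → ℤ × Bool →ᵇ ℂ := fun r =>
    BoundedContinuousFunction.ofNormedAddCommGroupDiscrete
      (fun i => waveAmplitude P r.1 * coupling κ K (ρ i.1) (ρ (neighbour r.1 i.1)) i.2 r.2 *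
        (decay (neighbour r.1 i.1) / decay i.1 : ℝ)) (‖P‖ * (2 * |κ|) * 2) fun i => by
      rw [norm_mul, norm_mul, norm_waveAmplitude, norm_real, norm_real, Real.norm_eq_abs,
        Real.norm_of_nonneg (div_nonneg (decay_pos _).le (decay_pos _).le)]
      gcongr
      · exact div_nonneg (decay_pos _).le (decay_pos _).le
      · exact abs_coupling_le hK (hρ _) (hρ _) (hnb _ _) _ _
      · rw [div_le_iff₀ (decay_pos _)]
        exact decay_le (natAbs_le_neighbour _ _)
  have hG : ∀ r i, G r i = waveAmplitude P r.1 *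
      coupling κ K (ρ i.1) (ρ (neighbour r.1 i.1)) i.2 r.2 *
        (decay (neighbour r.1 i.1) / decay i.1 : ℝ) := fun _ _ => rfl
  set T := bandOperator G fun r i => (neighbour r.1 i.1, r.2) with hT
  set d : ℤ × Bool → ℂ := fun i => I * (θ + N * (i.1 * C - sgn i.2 * χ i.1) : ℝ) with hd
  have hmass : ∀ i i' : ℤ × Bool, T (pointMass i) i' =
      ∑ r : Bool × Bool, G r i' * if (neighbour r.1 i'.1, r.2) = i then 1 else 0 := fun i i' => by
    rw [hT, bandOperator_apply]
    refine Finset.sum_congr rfl fun r _ => ?_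
    split_ifs with h
    · rw [h, pointMass_self]
    · rw [pointMass_of_ne h]
  have key := exists_eigenvalue_of_resonance T d (I * (θ - N * χ 0 : ℝ))
    (i₁ := (0, true)) (i₂ := (-1, false)) (by simp) (by simp [hd, sgn]; ring)
    (by simp [hd, sgn, ← hres]; ring) (mul_pos hN hg)
    (fun i h1 h2 => by
      have := hgap i.1 i.2 h1 h2
      rw [hd]
      rw [← mul_sub, norm_mul, norm_I, one_mul, ← ofReal_sub, norm_real, Real.norm_eq_abs,
        show θ - N * χ 0 - (θ + N * (i.1 * C - sgn i.2 * χ i.1)) =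
          N * -(χ 0 + i.1 * C - sgn i.2 * χ i.1) by ring, abs_mul, abs_neg, abs_of_pos hN]
      exact mul_le_mul_of_nonneg_left this hN.le)
    (by rw [hmass]; simp [Fintype.sum_prod_type, neighbour])
    (by rw [hmass]; simp [Fintype.sum_prod_type, neighbour])
    -- The amplitudes `P` and `-conj P` multiply to `-‖P‖²`, the couplings to a negative number, so
    -- `σ` is a positive real.
    (σ := √(‖P‖ ^ 2 * -(coupling κ K (ρ 0) (ρ (-1)) true false *
      coupling κ K (ρ (-1)) (ρ 0) false true)))
    (by
      rw [ofReal_re]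
      have := coupling_mul_coupling_neg hκ hK (hρ 0) (hρ (-1)) (by simpa [neighbour] using hnb false 0)
      have := norm_pos_iff.2 hP
      apply Real.sqrt_pos.2
      apply mul_pos (by positivity)
      linarith)
    (by
      have h := coupling_mul_coupling_neg hκ hK (hρ 0) (hρ (-1)) (by simpa [neighbour] using hnb false 0)
      have h0 := norm_pos_iff.2 hP
      rw [← ofReal_pow, Real.sq_sqrt (mul_nonneg (by positivity) (by linarith)), hmass, hmass]
      simp only [Fintype.sum_prod_type, neighbour, hG, waveAmplitude, Fintype.sum_bool]
      -- The weight ratios `1/2` and `2` of the two hops cancel.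
      simp [decay]
      rw [← Complex.mul_conj']
      ring)
  filter_upwards [key] with e he
  obtain ⟨z, hz, y, hy, h⟩ := he
  refine ⟨z, hz, y, hy, fun j s => ?_⟩
  have hj := h (j, s)
  rw [hT, bandOperator_apply] at hj
  have hdj : (decay j : ℂ) ≠ 0 := ofReal_ne_zero.2 (decay_pos j).ne'
  have hsum : ∑ r : Bool × Bool, waveAmplitude P r.1 *
          coupling κ K (ρ j) (ρ (neighbour r.1 j)) s r.2 *
            (decay (neighbour r.1 j) * y (neighbour r.1 j, r.2)) =
      decay j * ∑ r : Bool × Bool, G r (j, s) * y (neighbour r.1 j, r.2) := by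
    rw [Finset.mul_sum]
    refine Finset.sum_congr rfl fun r _ => ?_
    rw [hG]
    push_cast
    field_simp
  rw [hsum]
  simp only [hd] at hj
  linear_combination (decay j : ℂ) * hj

/-! ### From the coupled modes to eigenfunctions -/

theorem sqrt_shiftSq_smul_le (μ : Fin 2 → ℝ) (k : Fin 2 → ℤ) (j : ℤ) :
    √(shiftSq μ (j • k)) ≤ (|(k 0 : ℝ)| + |(k 1 : ℝ)| + |μ 0| + |μ 1|) * (1 + j.natAbs) := by
  have hx := abs_add_le ((j : ℝ) * k 0) (μ 0)
  have hy := abs_add_le ((j : ℝ) * k 1) (μ 1)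
  rw [abs_mul] at hx hy
  have hj : (j.natAbs : ℝ) = |(j : ℝ)| := by rw [Nat.cast_natAbs, Int.cast_abs]
  have h0 := abs_nonneg (k 0 : ℝ)
  have h1 := abs_nonneg (k 1 : ℝ)
  have h2 := abs_nonneg (μ 0)
  have h3 := abs_nonneg (μ 1)
  have h4 := abs_nonneg (j : ℝ)
  have h : √(shiftSq μ (j • k)) ≤ |j * k 0 + μ 0| + |j * k 1 + μ 1| := by
    rw [Real.sqrt_le_left (by positivity)]
    have e0 := sq_abs (j * (k 0 : ℝ) + μ 0)
    have e1 := sq_abs (j * (k 1 : ℝ) + μ 1)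
    have := mul_nonneg (abs_nonneg (j * (k 0 : ℝ) + μ 0)) (abs_nonneg (j * (k 1 : ℝ) + μ 1))
    simp only [shiftSq, Pi.smul_apply, smul_eq_mul, Int.cast_mul]
    nlinarith
  rw [hj]
  nlinarith [mul_nonneg h4 h2, mul_nonneg h4 h3]

/-- The substitution `b = N (x₊ + x₋)`, `ω = |q| (x₊ - x₋)` diagonalizes the operator without wave.
Each bracket then combines into `coupling`, thanks to the polarization `B = N K P`, `W = K² P`. -/
theorem isEigenvalue_linearized_of_modes {N K : ℝ} (hN : N ≠ 0) {c : Fin 2 → ℝ}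
    {k : Fin 2 → ℤ} (hk : k ≠ 0) {P : ℂ} {μ : Fin 2 → ℝ} {ρ : ℤ → ℝ} (hρ0 : ∀ j, 0 < ρ j)
    (hρ : ∀ j, shiftSq μ (j • k) = ρ j ^ 2) {z : ℂ} (x : ℤ → Bool → ℂ) (C : ℝ)
    (hC : ∀ j s, ‖x j s‖ ≤ C * (1 / 2) ^ j.natAbs) {j₀ : ℤ} {s₀ : Bool} (hne : x j₀ s₀ ≠ 0)
    (hx : ∀ j s, I * (c 0 * (j * k 0 + μ 0) + c 1 * (j * k 1 + μ 1) -
        N * (sgn s * ((j * k 0 + μ 0) / ρ j)) : ℝ) * x j s +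
      ∑ r : Bool × Bool, waveAmplitude P r.1 *
        coupling (crossShift μ k 0) K (ρ j) (ρ (neighbour r.1 j)) s r.2 *
          x (neighbour r.1 j) r.2 = z * x j s) :
    IsEigenvalue (linearized N c k (N * K * P) (K ^ 2 * P) P μ) z := by
  set D := |(k 0 : ℝ)| + |(k 1 : ℝ)| + |μ 0| + |μ 1|
  have hD0 : 0 ≤ D := by positivity
  have hC0 : 0 ≤ C := by simpa using (norm_nonneg _).trans (hC 0 true)
  have hρle : ∀ j, ρ j ≤ D * (1 + j.natAbs) := fun j => by
    have := sqrt_shiftSq_smul_le μ k j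
    rwa [hρ, Real.sqrt_sq (hρ0 j).le] at this
  have hρc : ∀ j, (ρ j : ℂ) ≠ 0 := fun j => ofReal_ne_zero.2 (hρ0 j).ne'
  have hpsi : ∀ j, ρ j * (x j true - x j false) / (shiftSq μ (j • k) : ℂ) =
      (x j true - x j false) / ρ j := fun j => by
    rw [hρ]; push_cast; field_simp [hρc j]
  refine isEigenvalue_linearized_of_line hk (fun j => N * (x j true + x j false))
    (fun j => ρ j * (x j true - x j false)) (2 * (|N| + D) * C) ?_ ?_ (j₀ := j₀) ?_ ?_ ?_
  · intro j
    rw [norm_mul, norm_real, Real.norm_eq_abs]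
    have h1 := (norm_add_le (x j true) (x j false)).trans (add_le_add (hC j true) (hC j false))
    calc |N| * ‖x j true + x j false‖
        ≤ ((|N| + D) * (1 + j.natAbs)) * (C * (1 / 2) ^ j.natAbs + C * (1 / 2) ^ j.natAbs) := by
          gcongr
          have : 0 ≤ (|N| + D) * (j.natAbs : ℝ) := by positivity
          linarith
      _ = _ := by ring
  · intro j
    rw [norm_mul, norm_real, Real.norm_of_nonneg (hρ0 j).le]
    have h1 := (norm_sub_le (x j true) (x j false)).trans (add_le_add (hC j true) (hC j false))
    calc ρ j * ‖x j true - x j false‖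
        ≤ ((|N| + D) * (1 + j.natAbs)) * (C * (1 / 2) ^ j.natAbs + C * (1 / 2) ^ j.natAbs) := by
          gcongr
          refine (hρle j).trans ?_
          gcongr
          have := abs_nonneg N
          linarith
      _ = _ := by ring
  · by_contra! h
    have ha : x j₀ true + x j₀ false = 0 :=
      (mul_eq_zero.1 h.1).resolve_left (ofReal_ne_zero.2 hN)
    have hu : x j₀ true - x j₀ false = 0 := (mul_eq_zero.1 h.2).resolve_left (hρc j₀)
    have ht : x j₀ true = 0 := by linear_combination (ha + hu) / 2
    have hf : x j₀ false = 0 := by linear_combination (ha - hu) / 2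
    cases s₀
    exacts [hne hf, hne ht]
  · intro j
    have ht := hx j true
    have hf := hx j false
    rw [hpsi, hpsi, hpsi]
    simp only [Fintype.sum_prod_type, Fintype.sum_bool, neighbour, waveAmplitude, coupling, sgn,
      if_true, Bool.false_eq_true, if_false] at ht hf
    push_cast at ht hf
    simp only [map_mul, conj_ofReal]
    have h0 := hρc j
    have h1 := hρc (j - 1)
    have h2 := hρc (j + 1)
    rw [show z * (N * (x j true + x j false)) = N * (z * x j true + z * x j false) by ring,
      ← ht, ← hf]
    field_simp
    ring
  · intro j
    have ht := hx j true
    have hf := hx j false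
    rw [hpsi, hpsi]
    simp only [Fintype.sum_prod_type, Fintype.sum_bool, neighbour, waveAmplitude, coupling, sgn,
      if_true, Bool.false_eq_true, if_false] at ht hf
    push_cast at ht hf
    simp only [map_mul, map_pow, conj_ofReal]
    have h0 := hρc j
    have h1 := hρc (j - 1)
    have h2 := hρc (j + 1)
    rw [show z * (ρ j * (x j true - x j false)) = ρ j * (z * x j true - z * x j false) by ring,
      ← ht, ← hf]
    field_simp
    ring

/-! ### The resonant triad -/

/-- For `q = T k + h k^⊥` with `k = (m, n)`, this is `|k| q₁ / |q|`. -/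
def slope (m n h T : ℝ) : ℝ := (T * m - h * n) / √(T ^ 2 + h ^ 2)

theorem sqrt_sq_add_pos {h : ℝ} (hh : 0 < h) (T : ℝ) : 0 < √(T ^ 2 + h ^ 2) :=
  Real.sqrt_pos.2 (by positivity)

theorem lt_sqrt_sq_add {h : ℝ} (hh : 0 < h) (T : ℝ) : |T| < √(T ^ 2 + h ^ 2) := by
  rw [Real.lt_sqrt (abs_nonneg _), sq_abs]
  linarith [pow_pos hh 2]

theorem le_sqrt_sq_add {h : ℝ} (T : ℝ) : h ≤ √(T ^ 2 + h ^ 2) :=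
  Real.le_sqrt_of_sq_le (by linarith [sq_nonneg T])

theorem slope_lt {m n h : ℝ} (hm : 0 < m) (hn : 0 < n) (hh : 0 < h) (T : ℝ) :
    slope m n h T < m := by
  rw [slope, div_lt_iff₀ (sqrt_sq_add_pos hh T)]
  have := (le_abs_self T).trans_lt (lt_sqrt_sq_add hh T)
  nlinarith [mul_pos hh hn]

theorem half_le_slope {m n h T : ℝ} (hm : 0 < m) (hh : 0 < h) (hT : h * (2 * n / m + 1) ≤ T)
    (hT0 : 0 ≤ T) : m / 2 ≤ slope m n h T := by
  rw [slope, le_div_iff₀ (sqrt_sq_add_pos hh T)]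
  have h1 : √(T ^ 2 + h ^ 2) ≤ T + h := by
    rw [Real.sqrt_le_left (by positivity)]
    nlinarith [mul_nonneg hT0 hh.le]
  have h2 : m * (h * (2 * n / m + 1)) = 2 * (h * n) + m * h := by field_simp
  have h3 := mul_le_mul_of_nonneg_left hT hm.le
  nlinarith

theorem continuous_slope {m n h : ℝ} (hh : 0 < h) : Continuous (slope m n h) := by
  unfold slope
  exact Continuous.div (by fun_prop) (by fun_prop) fun T => (sqrt_sq_add_pos hh T).ne'

/-- The resonance `Ω(q) + Ω(q - k) = Ω(k)` on the line at distance `h |k|` from the origin. -/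
theorem exists_resonance {m n h : ℝ} (hm : 0 < m) (hn : 0 < n) (hh : 0 < h) :
    ∃ T : ℝ, slope m n h T + slope m n h (T - 1) = m := by
  have hcont : Continuous fun T => slope m n h T + slope m n h (T - 1) :=
    (continuous_slope hh).add ((continuous_slope hh).comp (by fun_prop))
  set S := h * (2 * n / m + 1)
  have hS0 : 0 < S := by positivity
  -- At `T = 1` the second vector is `h k^⊥`, whose first component is negative.
  have h1 : slope m n h 1 + slope m n h (1 - 1) ≤ m := by
    have h0 : slope m n h (1 - 1) ≤ 0 := by
      rw [slope]
      apply div_nonpos_of_nonpos_of_nonneg _ (Real.sqrt_nonneg _)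
      nlinarith [mul_pos hh hn]
    linarith [slope_lt hm hn hh 1]
  have h2 : m ≤ slope m n h (S + 1) + slope m n h (S + 1 - 1) := by
    have e1 := half_le_slope (n := n) hm hh (show S ≤ S + 1 by linarith) (by linarith)
    have e2 := half_le_slope (n := n) hm hh (show S ≤ S + 1 - 1 by linarith) (by linarith)
    linarith
  exact mem_range_of_exists_le_of_exists_ge hcont ⟨1, h1⟩ ⟨S + 1, h2⟩

/-- Only the two resonant modes have the resonant frequency. -/
theorem gap_of_resonance {m n h T : ℝ} (hm : 0 < m) (hn : 0 < n) (hh : 1 ≤ h)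
    (hres : slope m n h T + slope m n h (T - 1) = m) (j : ℤ) (s : Bool)
    (h1 : (j, s) ≠ ((0 : ℤ), true)) (h2 : (j, s) ≠ ((-1 : ℤ), false)) :
    min (slope m n h T) (slope m n h (T - 1)) ≤
      |slope m n h T + j * m - sgn s * slope m n h (T + j)| := by
  have hh0 : 0 < h := by linarith
  have hlt := slope_lt hm hn hh0
  have hp0 : 0 < slope m n h (T - 1) := by linarith [hlt T]
  have hp1 : 0 < slope m n h T := by linarith [hlt (T - 1)]
  -- Positivity of the slope at `T - 1` is positivity of its numerator; it controls the signs and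
  -- sizes at the other `j`.
  have hnum : 0 < (T - 1) * m - h * n := by
    have := mul_pos hp0 (sqrt_sq_add_pos hh0 (T - 1))
    rwa [slope, div_mul_cancel₀ _ (sqrt_sq_add_pos hh0 (T - 1)).ne'] at this
  rcases lt_trichotomy j 0 with hj | rfl | hj
  · by_cases hj1 : j = -1
    · subst hj1
      have hs : s = true := by by_contra h; simp_all
      subst hs
      rw [le_abs]
      right
      have e : T + ((-1 : ℤ) : ℝ) = T - 1 := by push_cast; ring
      simp only [sgn, if_true, e]
      push_cast
      linarith [min_le_right (slope m n h T) (slope m n h (T - 1))]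
    · have hjr : (j : ℝ) ≤ -2 := by exact_mod_cast (by omega : j ≤ -2)
      -- The numerator exceeds `(j + 1) m ≤ 0`, and dividing by a length `≥ 1` only raises a
      -- negative number; this is where `1 ≤ h` enters.
      have hlow : (j + 1) * m ≤ slope m n h (T + j) := by
        rw [slope, le_div_iff₀ (sqrt_sq_add_pos hh0 _)]
        have h3 : 1 ≤ √((T + j) ^ 2 + h ^ 2) := hh.trans (le_sqrt_sq_add _)
        have h4 : (j + 1) * m ≤ 0 := by nlinarith
        nlinarith [mul_nonneg (neg_nonneg.2 h4) (sub_nonneg.2 h3)]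
      have hup := hlt (T + j)
      refine (min_le_right _ _).trans (le_abs.2 (Or.inr ?_))
      cases s
      · simp only [sgn, Bool.false_eq_true, if_false]
        nlinarith
      · simp only [sgn, if_true]
        linarith
  · have hs : s = false := by by_contra h; simp_all
    subst hs
    rw [le_abs]
    left
    simp only [sgn, Bool.false_eq_true, if_false]
    push_cast
    rw [add_zero]
    linarith [min_le_left (slope m n h T) (slope m n h (T - 1))]
  · have hjr : (1 : ℝ) ≤ j := by exact_mod_cast hj
    have hlow : 0 ≤ slope m n h (T + j) := by
      apply div_nonneg _ (Real.sqrt_nonneg _)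
      nlinarith
    have hup := hlt (T + j)
    refine (min_le_left _ _).trans (le_abs.2 (Or.inl ?_))
    cases s
    · simp only [sgn, Bool.false_eq_true, if_false]
      nlinarith
    · simp only [sgn, if_true]
      nlinarith

/-- Strict triangle inequality for `q` and `k`, in units of `|k|`; strict because `h > 0` makes them
non-parallel. -/
theorem sqrt_sq_add_lt {h : ℝ} (hh : 0 < h) {S T : ℝ} (hST : |S - T| = 1) :
    √(S ^ 2 + h ^ 2) < √(T ^ 2 + h ^ 2) + 1 := by
  have h0 := Real.sqrt_nonneg (T ^ 2 + h ^ 2)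
  rw [Real.sqrt_lt' (by linarith)]
  have h1 := Real.sq_sqrt (show 0 ≤ T ^ 2 + h ^ 2 by positivity)
  have h2 := abs_lt.1 (lt_sqrt_sq_add hh T)
  rcases (abs_eq zero_le_one).1 hST with h3 | h3
  · obtain rfl : S = T + 1 := by linarith
    nlinarith
  · obtain rfl : S = T - 1 := by linarith
    nlinarith

/-! ### The polarization of a plane wave -/

theorem planeWave_eq (A : ℂ) (k : Fin 2 → ℤ) (Ω t x y : ℝ) :
    planeWave A k Ω t x y = 2 * (A.re * Real.cos (k 0 * x + k 1 * y - Ω * t) -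
      A.im * Real.sin (k 0 * x + k 1 * y - Ω * t)) := by
  rw [planeWave, mul_comm I, mul_re, exp_ofReal_mul_I_re, exp_ofReal_mul_I_im]

/-- The derivative of `A e^{iφ} + c.c.` in the phase. -/
def phaseDeriv (A : ℂ) (φ : ℝ) : ℝ := 2 * (A.re * -Real.sin φ - A.im * Real.cos φ)

theorem hasDerivAt_phase (A : ℂ) {φ : ℝ → ℝ} {a s : ℝ} (hφ : HasDerivAt φ a s) :
    HasDerivAt (fun s => 2 * (A.re * Real.cos (φ s) - A.im * Real.sin (φ s)))
      (a * phaseDeriv A (φ s)) s := by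
  refine (((hφ.cos.const_mul A.re).sub (hφ.sin.const_mul A.im)).const_mul 2).congr_deriv ?_
  simp only [phaseDeriv]
  ring

theorem dx_planeWave (A : ℂ) (k : Fin 2 → ℤ) (Ω t x y : ℝ) :
    dx (planeWave A k Ω t) x y = k 0 * phaseDeriv A (k 0 * x + k 1 * y - Ω * t) := by
  unfold dx
  simp only [planeWave_eq]
  refine (hasDerivAt_phase A ?_).deriv
  simpa using ((((hasDerivAt_id x).const_mul (k 0 : ℝ)).add_const (k 1 * y)).sub_const (Ω * t))

theorem dy_planeWave (A : ℂ) (k : Fin 2 → ℤ) (Ω t x y : ℝ) :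
    dy (planeWave A k Ω t) x y = k 1 * phaseDeriv A (k 0 * x + k 1 * y - Ω * t) := by
  unfold dy
  simp only [planeWave_eq]
  refine (hasDerivAt_phase A ?_).deriv
  simpa using ((((hasDerivAt_id y).const_mul (k 1 : ℝ)).const_add (k 0 * x)).sub_const (Ω * t))

theorem deriv_time_planeWave (A : ℂ) (k : Fin 2 → ℤ) (Ω t x y : ℝ) :
    deriv (fun s => planeWave A k Ω s x y) t =
      -Ω * phaseDeriv A (k 0 * x + k 1 * y - Ω * t) := by
  simp only [planeWave_eq]
  refine (hasDerivAt_phase A ?_).deriv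
  simpa using ((hasDerivAt_id t).const_mul Ω).const_sub ((k 0 : ℝ) * x + k 1 * y)

theorem poisson_planeWave (A B : ℂ) (k : Fin 2 → ℤ) (Ω t x y : ℝ) :
    poisson (planeWave A k Ω t) (planeWave B k Ω t) x y = 0 := by
  simp only [poisson, dx_planeWave, dy_planeWave]
  ring

/-- Parallel waves have zero bracket, so the buoyancy equation is linear. Phases `0` and `π/2`
isolate imaginary and real parts. -/
theorem polarization_of_isSolution {N Ω : ℝ} {k : Fin 2 → ℤ} (hk : k 0 ≠ 0) {B W P : ℂ}
    (h : IsSolution N (planeWave B k Ω) (planeWave W k Ω) (planeWave P k Ω)) :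
    (Ω : ℂ) * B = N ^ 2 * k 0 * P := by
  have hk' : (k 0 : ℝ) ≠ 0 := by exact_mod_cast hk
  have key : ∀ φ : ℝ, Ω * phaseDeriv B φ = N ^ 2 * k 0 * phaseDeriv P φ := fun φ => by
    have := h.buoyancy 0 (φ / k 0) 0
    rw [poisson_planeWave, deriv_time_planeWave, dx_planeWave, mul_zero, mul_zero, add_zero,
      sub_zero, mul_div_cancel₀ _ hk'] at this
    linarith
  have h0 := key 0
  have h1 := key (Real.pi / 2)
  simp only [phaseDeriv, Real.sin_zero, Real.cos_zero, Real.sin_pi_div_two,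
    Real.cos_pi_div_two] at h0 h1
  apply Complex.ext
  · have : ((N : ℂ) ^ 2 * k 0 * P).re = N ^ 2 * k 0 * P.re := by
      rw [← ofReal_pow, ← ofReal_intCast, ← ofReal_mul, re_ofReal_mul]
    rw [this, re_ofReal_mul]
    linarith
  · have : ((N : ℂ) ^ 2 * k 0 * P).im = N ^ 2 * k 0 * P.im := by
      rw [← ofReal_pow, ← ofReal_intCast, ← ofReal_mul, im_ofReal_mul]
    rw [this, im_ofReal_mul]
    linarith

/-! ### The unstable Floquet exponent -/

theorem exists_unstable_eigenvalue {N : ℝ} (hN : 0 < N) {k : Fin 2 → ℤ} (hm : 0 < k 0)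
    (hn : 0 < k 1) {P : ℂ} (hP : P ≠ 0) :
    ∃ μ : Fin 2 → ℝ, (∀ p : Fin 2 → ℤ, (fun j => (p j : ℝ)) ≠ μ) ∧
      ∀ᶠ ε : ℝ in 𝓝 0, 0 < ε → ∃ z : ℂ, 0 < z.re ∧
        IsEigenvalue (linearized N (fun j => freq N k * (k j : ℝ) / normSqZ k) k
          (N * √(normSqZ k) * (ε * P)) ((√(normSqZ k) : ℝ) ^ 2 * (ε * P)) (ε * P) μ) z := by
  have hmr : (0 : ℝ) < k 0 := by exact_mod_cast hm
  have hnr : (0 : ℝ) < k 1 := by exact_mod_cast hn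
  have hS : 0 < normSqZ k := by unfold normSqZ; positivity
  set K := √(normSqZ k) with hKdef
  have hK : 0 < K := Real.sqrt_pos.2 hS
  have hK2 : K ^ 2 = (k 0 : ℝ) ^ 2 + (k 1 : ℝ) ^ 2 := Real.sq_sqrt hS.le
  have hSK : normSqZ k = K ^ 2 := (Real.sq_sqrt hS.le).symm
  -- `h > 1` makes every `|μ + j k|` exceed `|k|`, and `2 h |k|²` is an odd integer, which excludes
  -- `μ ∈ ℤ²`.
  set h : ℝ := 1 + 1 / (2 * K ^ 2) with hh
  have hh1 : 1 < h := by rw [hh]; linarith [show 0 < 1 / (2 * K ^ 2) by positivity]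
  have hh0 : 0 < h := by linarith
  have hhK : 2 * (h * K ^ 2) = 2 * K ^ 2 + 1 := by rw [hh]; field_simp
  obtain ⟨T, hT⟩ := exists_resonance hmr hnr hh0
  set μ : Fin 2 → ℝ := ![T * k 0 - h * k 1, T * k 1 + h * k 0]
  have μ0 : μ 0 = T * k 0 - h * k 1 := rfl
  have μ1 : μ 1 = T * k 1 + h * k 0 := rfl
  set ρ : ℤ → ℝ := fun j => K * √((T + j) ^ 2 + h ^ 2) with hρ
  set χ : ℤ → ℝ := fun j => slope (k 0) (k 1) h (T + j) / K with hχ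
  have hcross : crossShift μ k 0 = -(h * K ^ 2) := by
    rw [hK2]; simp only [crossShift, Pi.zero_apply, μ0, μ1]; push_cast; ring
  have hρ0 : ∀ j, 0 < ρ j := fun j => mul_pos hK (sqrt_sq_add_pos hh0 _)
  have hshift : ∀ j : ℤ, shiftSq μ (j • k) = ρ j ^ 2 := fun j => by
    rw [hρ, mul_pow, Real.sq_sqrt (show 0 ≤ (T + j) ^ 2 + h ^ 2 by positivity), hK2]
    simp only [shiftSq, μ0, μ1, Pi.smul_apply, smul_eq_mul]
    push_cast
    ring
  have hχρ : ∀ j : ℤ, (j * k 0 + μ 0) / ρ j = χ j := fun j => by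
    simp only [hρ, hχ, slope, μ0]
    rw [div_div, mul_comm K]
    congr 1
    ring
  refine ⟨μ, fun p hp => ?_, ?_⟩
  · have e : crossShift μ k 0 = ((p 0 * k 1 - p 1 * k 0 : ℤ) : ℝ) := by
      rw [← hp]; simp [crossShift]
    -- For an integer `μ` this would equate an even and an odd integer.
    have e' : 2 * (p 0 * k 1 - p 1 * k 0) = -(2 * (k 0 ^ 2 + k 1 ^ 2) + 1) := by
      have : 2 * ((p 0 * k 1 - p 1 * k 0 : ℤ) : ℝ) = -(2 * (k 0 ^ 2 + k 1 ^ 2) + 1) := by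
        rw [← e, hcross, ← hK2, ← hhK]; ring
      exact_mod_cast this
    omega
  have hev := exists_unstable_modes (N := N) (K := K) (κ := crossShift μ k 0) (C := k 0 / K)
    (θ := N * (k 0 / K) * T)
    (g := min (slope (k 0) (k 1) h T) (slope (k 0) (k 1) h (T - 1)) / K) (ρ := ρ) (χ := χ)
    hN hK (by rw [hcross]; exact (neg_neg_of_pos (by positivity)).ne)
    (fun j => by
      have := hh1.trans_le (le_sqrt_sq_add (h := h) (T + j))
      simp only [hρ]
      nlinarith)
    (fun δ j => by
      have : |T + (neighbour δ j : ℝ) - (T + j)| = 1 := by cases δ <;> simp [neighbour]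
      have := sqrt_sq_add_lt hh0 this
      simp only [hρ]
      nlinarith)
    (by
      simp only [hχ]
      rw [← add_div]
      push_cast
      rw [add_zero, ← sub_eq_add_neg, hT])
    (by
      have h1 := slope_lt hmr hnr hh0 T
      have h2 := slope_lt hmr hnr hh0 (T - 1)
      exact div_pos (lt_min (by linarith) (by linarith)) hK)
    (fun j s h1 h2 => by
      have := gap_of_resonance hmr hnr hh1.le hT j s h1 h2
      have e : χ 0 + j * (k 0 / K) - sgn s * χ j = (slope (k 0) (k 1) h T + j * k 0 -
          sgn s * slope (k 0) (k 1) h (T + j)) / K := by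
        simp only [hχ]
        push_cast
        rw [add_zero]
        ring
      rw [e, abs_div, abs_of_pos hK]
      gcongr)
    hP
  have hreal : Tendsto (fun ε : ℝ => (ε : ℂ)) (𝓝 0) (𝓝 0) := continuous_ofReal.tendsto 0
  filter_upwards [hreal.eventually hev] with ε hε hpos
  obtain ⟨z, hz, y, hy, heq⟩ := hε
  obtain ⟨⟨j₀, s₀⟩, hne⟩ : ∃ i, y i ≠ 0 := by
    by_contra! h0
    exact hy (BoundedContinuousFunction.ext h0)
  refine ⟨I * (N * (k 0 / K) * T - N * χ 0 : ℝ) + ε * z, ?_, ?_⟩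
  · rw [add_re, re_ofReal_mul, I_mul_re, ofReal_im, neg_zero, zero_add]
    exact mul_pos hpos hz
  refine isEigenvalue_linearized_of_modes hN.ne' (fun h0 => hm.ne' (congrFun h0 0)) hρ0 hshift
    (fun j s => decay j * y (j, s)) ‖y‖ (fun j s => ?_) (j₀ := j₀) (s₀ := s₀)
    (mul_ne_zero (ofReal_ne_zero.2 (decay_pos _).ne') hne) fun j s => ?_
  · rw [norm_mul, norm_real, Real.norm_of_nonneg (decay_pos j).le, mul_comm, decay]
    exact mul_le_mul_of_nonneg_right (y.norm_coe_le_norm _) (by positivity)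
  · rw [← heq j s, hχρ, Finset.mul_sum]
    congr 1
    · congr 3
      rw [hSK, freq, ← hKdef, μ0, μ1]
      field_simp
      linear_combination (-(k 0 * (j + T))) * hK2
    · refine Finset.sum_congr rfl fun r _ => ?_
      have : waveAmplitude (ε * P) r.1 = ε * waveAmplitude P r.1 := by
        cases r.1 <;> simp [waveAmplitude]
      rw [this]
      ring

end Boussinesq

end

theorem mainTheorem1 (N : ℝ) (hN : 0 < N) (m n : ℤ) (hm : 0 < m) (hn : 0 < n)
    (U : ℂ × ℂ) (hU : U ≠ 0)
    (hwave : ∀ ε : ℝ, 0 < ε → Boussinesq.IsSolution N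
      (Boussinesq.planeWave (ε * U.1) ![m, n] (Boussinesq.freq N ![m, n]))
      (Boussinesq.planeWave (ε * U.2) ![m, n] (Boussinesq.freq N ![m, n]))
      (Boussinesq.planeWave (ε * U.2 / (Boussinesq.normSqZ ![m, n] : ℂ)) ![m, n]
        (Boussinesq.freq N ![m, n]))) :
    ∃ ε₀ : ℝ, 0 < ε₀ ∧ ∀ ε : ℝ, 0 < ε → ε ≤ ε₀ →
      ∃ μ : Fin 2 → ℝ, (∀ k : Fin 2 → ℤ, (fun j => (k j : ℝ)) ≠ μ) ∧
        ∃ z : ℂ, 0 < z.re ∧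
          Boussinesq.IsEigenvalue (Boussinesq.waveOperator N ![m, n] U ε μ) z := by
  have hk0 : (![m, n] : Fin 2 → ℤ) 0 = m := rfl
  have hmr : (0 : ℝ) < m := by exact_mod_cast hm
  have hS : 0 < Boussinesq.normSqZ ![m, n] := by
    rw [Boussinesq.normSqZ, hk0]; positivity
  have hK := Real.sqrt_pos.2 hS
  have hSK : ((√(Boussinesq.normSqZ ![m, n]) : ℝ) : ℂ) ^ 2 = Boussinesq.normSqZ ![m, n] := by
    rw [← Complex.ofReal_pow, Real.sq_sqrt hS.le]
  have hKc : ((√(Boussinesq.normSqZ ![m, n]) : ℝ) : ℂ) ≠ 0 := Complex.ofReal_ne_zero.2 hK.ne'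
  have hNc : (N : ℂ) ≠ 0 := Complex.ofReal_ne_zero.2 hN.ne'
  have hmc : (m : ℂ) ≠ 0 := by exact_mod_cast hm.ne'
  set P : ℂ := U.2 / Boussinesq.normSqZ ![m, n] with hPdef
  have hU2 : U.2 = ((√(Boussinesq.normSqZ ![m, n]) : ℝ) : ℂ) ^ 2 * P := by
    rw [hPdef, hSK, mul_div_cancel₀ _ (Complex.ofReal_ne_zero.2 hS.ne')]
  have hU1 : U.1 = N * (√(Boussinesq.normSqZ ![m, n]) : ℝ) * P := by
    have h := Boussinesq.polarization_of_isSolution (k := ![m, n]) hm.ne' (hwave 1 one_pos)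
    rw [Complex.ofReal_one, one_mul, one_mul, ← hPdef, Boussinesq.freq, hk0] at h
    push_cast at h
    field_simp at h
    linear_combination h
  have hP : P ≠ 0 := fun h0 => hU (Prod.ext (by rw [hU1, h0, mul_zero]; rfl)
    (by rw [hU2, h0, mul_zero]; rfl))
  obtain ⟨μ, hμ, hev⟩ := Boussinesq.exists_unstable_eigenvalue (k := ![m, n]) hN hm hn hP
  obtain ⟨δ, hδ, hball⟩ := Metric.eventually_nhds_iff.1 hev
  -- Half the radius, since the ball is open and `ε = ε₀` is allowed.
  refine ⟨δ / 2, half_pos hδ, fun ε hε hle => ⟨μ, hμ, ?_⟩⟩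
  obtain ⟨z, hz, heig⟩ := hball (y := ε) (by
    rw [Real.dist_eq, sub_zero, abs_of_pos hε]; linarith) hε
  refine ⟨z, hz, ?_⟩
  have e1 : (ε : ℂ) * U.1 = N * (√(Boussinesq.normSqZ ![m, n]) : ℝ) * (ε * P) := by
    rw [hU1]; ring
  have e2 : (ε : ℂ) * U.2 = ((√(Boussinesq.normSqZ ![m, n]) : ℝ) : ℂ) ^ 2 * (ε * P) := by
    rw [hU2]; ring
  have e3 : (ε : ℂ) * U.2 / Boussinesq.normSqZ ![m, n] = ε * P := by rw [hPdef, mul_div_assoc]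
  rw [Boussinesq.waveOperator, e3, e1, e2]
  exact heig
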